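/- A hyperbolic space is a geodesic metric space that is $\delta$-hyperbolic in the sense of Gromov for some $\delta\ge 0$ (no properness is assumed). Let $X_1,\dots,X_r$ be hyperbolic spaces and let $P=X_1\times\dots\times X_r$ carry the $\ell_1$ product metric. Suppose that a group $G$ acts on $P$ by isometries such that (a) the action preserves factors: every $g\in G$ acts as $(x_1,\dots,x_r)\mapsto(g_1(x_1),\dots,g_r(x_r))$ with $g_i\in\mathrm{Isom}(X_i)$ for each $i$; (b) the action is acylindrical: for every $\epsilon\ge 0$ there are $N$ and $R$ such that, whenever $x,y\in P$ satisfy $d(x,y)\ge R$, the set $\{g\in G : d(gx,x)\le\epsilon \text{ and } d(gy,y)\le\epsilon\}$ has at most $N$ elements. Then no element of $G$ acts parabolically on $P$. That is, every $g\in G$ acts either elliptically (the subgroup $\langle g\rangle$ has bounded orbits in $P$) or loxodromically (for $x\in P$ the orbit map $n\mapsto g^n x$ is a quasi-isometric embedding of $\mathbb{Z}$ in $P$). -/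

import Mathlib

/-- `X` is a geodesic metric space: any two points are joined by an isometrically embedded
compact interval. -/
def IsGeodesicSpace (X : Type*) [MetricSpace X] : Prop :=
  ∀ x y : X, ∃ γ : ℝ → X, γ 0 = x ∧ γ (dist x y) = y ∧
    ∀ s ∈ Set.Icc (0 : ℝ) (dist x y), ∀ t ∈ Set.Icc (0 : ℝ) (dist x y),
      dist (γ s) (γ t) = |s - t|

/-- The Gromov product `(x | y)_w`. -/
noncomputable def gromovProduct {X : Type*} [MetricSpace X] (w x y : X) : ℝ :=
  (dist x w + dist y w - dist x y) / 2

/-- A (Gromov) hyperbolic space: a geodesic metric space which is `δ`-hyperbolic for some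
`δ ≥ 0`. No properness is assumed. -/
def IsHyperbolicSpace (X : Type*) [MetricSpace X] : Prop :=
  IsGeodesicSpace X ∧
    ∃ δ : ℝ, 0 ≤ δ ∧ ∀ w x y z : X,
      min (gromovProduct w x y) (gromovProduct w y z) - δ ≤ gromovProduct w x z

/-- The action of `G` on the metric space `X` is acylindrical. -/
def IsAcylindricalAction (G X : Type*) [Group G] [MetricSpace X] [MulAction G X] : Prop :=
  ∀ ε : ℝ, 0 ≤ ε → ∃ (N : ℕ) (R : ℝ), ∀ x y : X, R ≤ dist x y →
    {g : G | dist (g • x) x ≤ ε ∧ dist (g • y) y ≤ ε}.encard ≤ N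

/-- `g` acts elliptically on `X`: the cyclic subgroup generated by `g` has bounded orbits. -/
def IsEllipticElement {G : Type*} (X : Type*) [Group G] [MetricSpace X] [MulAction G X]
    (g : G) : Prop :=
  ∀ x : X, Bornology.IsBounded (MulAction.orbit (Subgroup.zpowers g) x)

/-- `g` acts loxodromically on `X`: the orbit maps `n ↦ g ^ n • x` are quasi-isometric
embeddings of `ℤ` in `X`. -/
def IsLoxodromicElement {G : Type*} (X : Type*) [Group G] [MetricSpace X] [MulAction G X]
    (g : G) : Prop :=
  ∀ x : X, ∃ K C : ℝ, 1 ≤ K ∧ 0 ≤ C ∧ ∀ m n : ℤ,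
    |(m : ℝ) - n| / K - C ≤ dist (g ^ m • x) (g ^ n • x) ∧
      dist (g ^ m • x) (g ^ n • x) ≤ K * |(m : ℝ) - n| + C

/-- `g` acts parabolically on `X`: neither elliptically nor loxodromically. -/
def IsParabolicElement {G : Type*} (X : Type*) [Group G] [MetricSpace X] [MulAction G X]
    (g : G) : Prop :=
  ¬ IsEllipticElement X g ∧ ¬ IsLoxodromicElement X g

/-- The action of `G` on the `ℓ¹`-product of the `X i` preserves factors: every `g` acts as
`(g₁, …, g_r)` with `g_i` an isometry of `X i` onto itself. -/
def PreservesFactors (G : Type*) [Group G] {r : ℕ} (X : Fin r → Type*)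
    [∀ i, MetricSpace (X i)] [MulAction G (PiLp 1 X)] : Prop :=
  ∀ g : G, ∃ h : ∀ i, X i ≃ᵢ X i, ∀ (p : PiLp 1 X) (i : Fin r), (g • p) i = h i (p i)

/-! If `g` is not loxodromic, no power of a coordinate isometry `h i` has linear growth, because
coordinate projections are 1-Lipschitz. By `FourPoint.linear_growth`, squaring such a power then
adds at most `2 * δ + 1` to the displacement of any point. If the orbit of `x` in a factor is
unbounded, small powers nearly translate the deep interior of a long geodesic from `x` to `(h ^ M)
x`. Squaring doubles the translation length up to `O(δ)`, so that length is itself `O(δ)`, however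
many powers are tested (`FourPoint.dist_le_of_between`). A factor with bounded orbit contributes its
base point. Together these give far apart points of the product that arbitrarily many powers of `g`
almost fix; acylindricity makes `g` of finite order, hence elliptic. -/

/-- Gromov hyperbolicity in its four-point form: of the three sums of opposite distances, each is
at most the maximum of the other two, up to `2 * δ`. -/
def FourPoint (X : Type*) [MetricSpace X] (δ : ℝ) : Prop :=
  ∀ w x y z : X, dist x z + dist y w ≤ dist x y + dist z w + 2 * δ ∨
    dist x z + dist y w ≤ dist y z + dist x w + 2 * δ

theorem IsHyperbolicSpace.exists_fourPoint {X : Type*} [MetricSpace X]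
    (hX : IsHyperbolicSpace X) : ∃ δ : ℝ, 0 ≤ δ ∧ FourPoint X δ := by
  obtain ⟨-, δ, hδ, h⟩ := hX
  refine ⟨δ, hδ, fun w x y z => ?_⟩
  have := h w x y z
  unfold gromovProduct at this
  rcases min_cases ((dist x w + dist y w - dist x y) / 2)
    ((dist y w + dist z w - dist y z) / 2) with ⟨h1, -⟩ | ⟨h1, -⟩ <;> rw [h1] at this
  · left; linarith
  · right; linarith

/-! ### Isometries of one hyperbolic space. -/

section Isometry

variable {X : Type*} [MetricSpace X]

theorem dist_isometryEquiv_pow_le (h : X ≃ᵢ X) (x : X) (k : ℕ) :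
    dist ((h ^ k) x) x ≤ k * dist (h x) x := by
  induction k with
  | zero => simp
  | succ k ih =>
    have h1 : dist ((h ^ (k + 1)) x) ((h ^ k) x) = dist (h x) x := by
      rw [pow_succ, IsometryEquiv.mul_apply, IsometryEquiv.dist_eq]
    have h2 := dist_triangle ((h ^ (k + 1)) x) ((h ^ k) x) x
    push_cast
    linarith

/-- If `g ^ 2` displaces a point by noticeably more than `g` does, then the displacement of that
point by the powers of `g` grows linearly. -/
theorem FourPoint.linear_growth {δ : ℝ} (hδ : 0 ≤ δ) (hX : FourPoint X δ) (g : X ≃ᵢ X) (p : X)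
    (hp : dist p (g p) + 2 * δ + 1 < dist p (g (g p))) (n : ℕ) :
    (n : ℝ) - 1 ≤ dist ((g ^ n) p) p := by
  have shift : ∀ (k : ℕ) (q : X), (g ^ (k + 1)) q = g ((g ^ k) q) := fun k q => by
    rw [pow_succ', IsometryEquiv.mul_apply]
  -- In the four-point condition for `p`, `g p`, `g ^ 2 p`, `g ^ (n + 3) p`, one alternative
  -- contradicts the inductive hypothesis and the other is the next increment.
  have step : ∀ n : ℕ, dist p ((g ^ (n + 1)) p) + 1 ≤ dist p ((g ^ (n + 2)) p) := by
    intro n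
    induction n with
    | zero =>
      have e2 : (g ^ (0 + 2)) p = g (g p) := by rw [shift, shift]; simp
      have e1 : (g ^ (0 + 1)) p = g p := by simp
      rw [e1, e2]; linarith
    | succ n ih =>
      have e3 : dist (g p) ((g ^ (n + 1 + 2)) p) = dist p ((g ^ (n + 2)) p) := by
        rw [shift, g.dist_eq]
      have e2 : dist (g (g p)) ((g ^ (n + 1 + 2)) p) = dist p ((g ^ (n + 1)) p) := by
        rw [shift, shift, g.dist_eq, g.dist_eq]
      have e1 : dist (g p) (g (g p)) = dist p (g p) := g.dist_eq _ _
      have := hX ((g ^ (n + 1 + 2)) p) p (g p) (g (g p))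
      change dist p ((g ^ (n + 2)) p) + 1 ≤ _
      rcases this with h | h <;> linarith
  have key : ∀ n : ℕ, (n : ℝ) ≤ dist p ((g ^ (n + 1)) p) := by
    intro n
    induction n with
    | zero => simp
    | succ n ih => have := step n; push_cast; linarith
  rcases n with _ | n
  · simp
  · have := key n
    rw [dist_comm]; push_cast; linarith

/-- A point lying deep inside a geodesic whose endpoints are displaced little by `g` and `g ^ 2`
is displaced by a uniformly bounded amount, unless `g` has linear growth. -/
theorem FourPoint.dist_le_of_between {δ : ℝ} (hδ : 0 ≤ δ) (hX : FourPoint X δ) (g : X ≃ᵢ X)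
    {x z p : X} {L : ℝ} (hx1 : dist (g x) x ≤ L) (hx2 : dist (g (g x)) x ≤ L)
    (hz1 : dist (g z) z ≤ L) (hz2 : dist (g (g z)) z ≤ L)
    (hp : dist x p + dist p z = dist x z)
    (hpx : 5 * L + 5 * δ < dist x p) (hpz : 5 * L + 5 * δ < dist p z)
    (hg : dist p (g (g p)) ≤ dist p (g p) + 2 * δ + 1) :
    dist (g p) p ≤ 16 * δ + 1 := by
  have hL : 0 ≤ L := dist_nonneg.trans hx1
  -- Both `g p` and `g (g p)` stay almost between `x` and `z`, with an error free of `L`.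
  have near : ∀ f : X ≃ᵢ X, dist (f x) x ≤ L → dist (f z) z ≤ L →
      dist x (f p) + dist (f p) z ≤ dist x z + 4 * δ := by
    intro f h1 h2
    have a1 : dist (f x) (f p) = dist x p := f.dist_eq _ _
    have a2 : dist (f z) (f p) = dist p z := by rw [f.dist_eq, dist_comm]
    have a3 : dist (f x) (f z) = dist x z := f.dist_eq _ _
    have b1 := hX (f p) (f x) z (f z)
    have b2 := hX (f p) z x (f x)
    have c1 := dist_triangle (f z) z (f p)
    have c2 := dist_triangle (f x) x (f p)
    have d1 := dist_comm z (f p)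
    have d2 := dist_comm z (f x)
    have d3 := dist_comm z (f z)
    have d4 := dist_comm x (f x)
    have d5 := dist_comm z x
    rcases b1 with b1 | b1 <;> rcases b2 with b2 | b2 <;> linarith
  have n0 : dist x p + dist p z ≤ dist x z + 4 * δ := by linarith
  have n1 := near g hx1 hz1
  have n2 := near (g * g) hx2 hz2
  simp only [IsometryEquiv.mul_apply] at n2
  have compare : ∀ q q' : X, dist x q + dist q z ≤ dist x z + 4 * δ →
      dist x q' + dist q' z ≤ dist x z + 4 * δ →
      dist q q' ≤ |dist x q - dist x q'| + 6 * δ := by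
    intro q q' h h'
    have d1 := dist_comm x q
    have d2 := dist_comm x q'
    have := le_abs_self (dist x q - dist x q')
    have := neg_le_abs (dist x q - dist x q')
    rcases hX z q x q' with b | b <;> linarith
  have k1 := compare p (g p) n0 n1
  have g1 : dist (g x) (g p) = dist x p := g.dist_eq _ _
  have g2 : dist (g x) (g (g p)) = dist x (g p) := g.dist_eq _ _
  have g3 : dist (g p) (g (g p)) = dist p (g p) := g.dist_eq _ _
  have t1 := dist_triangle x (g x) (g p)
  have t2 := dist_triangle (g x) x (g p)
  have t3 := dist_triangle (g x) x (g (g p))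
  have t4 := dist_triangle x (g x) (g (g p))
  have d1 := dist_comm x (g x)
  have d2 := dist_comm p (g p)
  have d3 := dist_comm (g p) x
  have d4 := dist_comm (g (g p)) x
  have d5 := dist_comm (g p) (g (g p))
  have hs : |dist x p - dist x (g p)| ≤ L := abs_le.2 ⟨by linarith, by linarith⟩
  -- With `s = dist x (g p) - dist x p`, `l1` and `l2` say that the second application of `g` shifts
  -- by `s ± 2δ`. So `2|s| - 2δ ≤ |s| + 6δ + 2δ + 1`, whence `|s| ≤ 10δ + 1`; `k1` adds `6δ`.
  have l1 : dist x (g (g p)) - dist x (g p) ≤ dist x (g p) - dist x p + 2 * δ := by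
    have := dist_comm (g x) (g (g p))
    rcases hX (g p) (g (g p)) (g x) x with b | b <;> linarith
  have l2 : dist x (g p) - dist x p - 2 * δ ≤ dist x (g (g p)) - dist x (g p) := by
    have := dist_comm (g x) (g p)
    rcases hX (g (g p)) (g p) (g x) x with b | b <;> linarith
  have tt := abs_dist_sub_le p (g (g p)) x
  rw [dist_comm p x, dist_comm (g (g p)) x] at tt
  obtain ⟨u1, u2⟩ := abs_le.1 tt
  rcases abs_cases (dist x p - dist x (g p)) with ⟨h, -⟩ | ⟨h, -⟩ <;> rw [h] at k1 <;> linarith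

/-- An isometry of a hyperbolic space with an unbounded orbit, none of whose powers has linear
growth, has pairs of far apart points that are uniformly almost fixed by many of its powers. -/
theorem FourPoint.exists_far_almost_fixed {δ : ℝ} (hδ : 0 ≤ δ) (hX : FourPoint X δ)
    (hgeo : IsGeodesicSpace X) (h : X ≃ᵢ X)
    (hslow : ∀ (k : ℕ) (p : X),
      dist p ((h ^ k) ((h ^ k) p)) ≤ dist p ((h ^ k) p) + 2 * δ + 1)
    (x : X) (hunb : ∀ B : ℝ, ∃ k : ℕ, B < dist ((h ^ k) x) x) (N : ℕ) (R : ℝ) :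
    ∃ p q : X, R ≤ dist p q ∧
      ∀ k ≤ N, dist ((h ^ k) p) p ≤ 16 * δ + 1 ∧ dist ((h ^ k) q) q ≤ 16 * δ + 1 := by
  -- The factor 2 covers the squares of `h ^ k` for `k ≤ N`. `L` depends on `N`, but only the margin
  -- `t` feels it.
  set L : ℝ := 2 * N * dist (h x) x with hLdef
  have hL : 0 ≤ L := by positivity
  set t : ℝ := 5 * L + 5 * δ + 1 with ht
  obtain ⟨M, hM⟩ := hunb (2 * t + |R|)
  set z := (h ^ M) x with hz
  have bx : ∀ k ≤ 2 * N, dist ((h ^ k) x) x ≤ L := by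
    intro k hk
    refine (dist_isometryEquiv_pow_le h x k).trans ?_
    have : (k : ℝ) ≤ 2 * N := by exact_mod_cast hk
    exact mul_le_mul_of_nonneg_right this dist_nonneg
  have bz : ∀ k ≤ 2 * N, dist ((h ^ k) z) z ≤ L := by
    intro k hk
    rw [hz, ← IsometryEquiv.mul_apply, ← pow_add, add_comm, pow_add, IsometryEquiv.mul_apply,
      IsometryEquiv.dist_eq]
    exact bx k hk
  have sq : ∀ (k : ℕ) (y : X), (h ^ k) ((h ^ k) y) = (h ^ (2 * k)) y := by
    intro k y
    rw [← IsometryEquiv.mul_apply, ← pow_add, two_mul]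
  obtain ⟨γ, γ0, γ1, hγ⟩ := hgeo x z
  have hR := abs_nonneg R
  have hD : 2 * t + |R| < dist x z := by rw [dist_comm]; exact hM
  have inner_pt : ∀ s : ℝ, t ≤ s → s ≤ dist x z - t → ∀ k ≤ N,
      dist ((h ^ k) (γ s)) (γ s) ≤ 16 * δ + 1 := by
    intro s h1 h2 k hk
    have e1 : dist x (γ s) = s := by
      have := hγ 0 ⟨le_rfl, dist_nonneg⟩ s ⟨by linarith, by linarith⟩
      rw [γ0] at this
      rw [this, zero_sub, abs_neg, abs_of_nonneg]; linarith
    have e2 : dist (γ s) z = dist x z - s := by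
      have := hγ s ⟨by linarith, by linarith⟩ (dist x z) ⟨dist_nonneg, le_rfl⟩
      rw [γ1] at this
      rw [this, abs_sub_comm, abs_of_nonneg]; linarith
    refine hX.dist_le_of_between hδ (h ^ k) (L := L) (bx k (by omega)) ?_ (bz k (by omega)) ?_
      (x := x) (z := z) (by linarith) (by linarith) (by linarith) (hslow k _)
    · rw [sq]; exact bx _ (by omega)
    · rw [sq]; exact bz _ (by omega)
  refine ⟨γ t, γ (t + |R|), ?_, fun k hk =>
    ⟨inner_pt t le_rfl (by linarith) k hk, inner_pt _ (by linarith) (by linarith) k hk⟩⟩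
  rw [hγ t ⟨by linarith, by linarith⟩ (t + |R|) ⟨by linarith, by linarith⟩]
  rw [show t - (t + |R|) = -|R| by ring, abs_neg, abs_abs]
  exact le_abs_self R

end Isometry

/-! ### Elliptic and loxodromic elements via natural powers. -/

section Action

variable {G X : Type*} [Group G] [MetricSpace X] [MulAction G X] [IsIsometricSMul G X]

theorem dist_zpow_smul_eq_natAbs (g : G) (x : X) (m n : ℤ) :
    dist (g ^ m • x) (g ^ n • x) = dist (g ^ (m - n).natAbs • x) x := by
  have key : dist (g ^ m • x) (g ^ n • x) = dist (g ^ (m - n) • x) x := by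
    conv_lhs => rw [show m = n + (m - n) by ring, zpow_add, mul_smul, dist_smul]
  rw [key]
  rcases Int.natAbs_eq (m - n) with h | h
  · conv_lhs => rw [h, zpow_natCast]
  · conv_lhs => rw [h, zpow_neg, zpow_natCast, ← dist_smul (g ^ (m - n).natAbs), smul_inv_smul,
      dist_comm]

theorem dist_pow_smul_le (g : G) (x : X) (k : ℕ) :
    dist (g ^ k • x) x ≤ k * dist (g • x) x := by
  induction k with
  | zero => simp
  | succ k ih =>
    have h1 : dist (g ^ (k + 1) • x) (g ^ k • x) = dist (g • x) x := by
      rw [pow_succ, mul_smul, dist_smul]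
    have h2 := dist_triangle (g ^ (k + 1) • x) (g ^ k • x) x
    push_cast
    linarith

theorem isEllipticElement_of_forall_pow {g : G}
    (hg : ∀ x : X, ∃ B : ℝ, ∀ k : ℕ, dist (g ^ k • x) x ≤ B) : IsEllipticElement X g := by
  intro x
  obtain ⟨B, hB⟩ := hg x
  refine (Metric.isBounded_closedBall (x := x) (r := B)).subset ?_
  rintro _ ⟨⟨_, n, rfl⟩, rfl⟩
  have := dist_zpow_smul_eq_natAbs g x n 0
  rw [zpow_zero, one_smul] at this
  exact Metric.mem_closedBall.2 (this.le.trans (hB _))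

/-- Linear growth of one orbit along the powers of one `g ^ k` makes `g` loxodromic. -/
theorem isLoxodromicElement_of_linear_growth {g : G} {k : ℕ} (y : X)
    (hy : ∀ n : ℕ, (n : ℝ) - 1 ≤ dist (g ^ (k * n) • y) y) : IsLoxodromicElement X g := by
  intro x
  have hk : 0 < k := by
    rcases Nat.eq_zero_or_pos k with rfl | hk
    · have := hy 2
      norm_num at this
    · exact hk
  have hk1 : (1 : ℝ) ≤ k := by exact_mod_cast hk
  set a := dist (g • x) x with ha
  have ha0 : 0 ≤ a := dist_nonneg
  have hxy : 0 ≤ dist x y := dist_nonneg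
  have lower : ∀ j : ℕ, (j : ℝ) / k - 2 - 2 * dist x y - k * a ≤ dist (g ^ j • x) x := by
    intro j
    have hj : j = k * (j / k) + j % k := (Nat.div_add_mod j k).symm
    have hr : j % k < k := Nat.mod_lt _ hk
    have h1 := hy (j / k)
    have h2 : dist (g ^ j • x) (g ^ (k * (j / k)) • x) ≤ k * a := by
      conv_lhs => rw [hj, pow_add, mul_smul, ← hj, dist_smul]
      refine (dist_pow_smul_le g x _).trans (mul_le_mul_of_nonneg_right ?_ ha0)
      exact_mod_cast hr.le
    have h3 : (j : ℝ) / k ≤ (j / k : ℕ) + 1 := by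
      rw [div_le_iff₀ (by linarith)]
      have : j ≤ (j / k + 1) * k := by
        rw [add_mul, one_mul, mul_comm]; omega
      exact_mod_cast this
    have h4 : dist (g ^ (k * (j / k)) • y) (g ^ (k * (j / k)) • x) = dist x y := by
      rw [dist_smul, dist_comm]
    have h5 := dist_triangle4 (g ^ (k * (j / k)) • y) (g ^ (k * (j / k)) • x) x y
    have h6 := dist_triangle (g ^ (k * (j / k)) • x) (g ^ j • x) x
    rw [dist_comm] at h2
    linarith
  refine ⟨k + a, 2 + 2 * dist x y + k * a, by linarith, by positivity, fun m n => ?_⟩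
  rw [dist_zpow_smul_eq_natAbs]
  have hc : |(m : ℝ) - n| = ((m - n).natAbs : ℝ) := by
    rw [Nat.cast_natAbs]; push_cast; rfl
  rw [hc]
  set j := (m - n).natAbs
  have hj0 : (0 : ℝ) ≤ j := Nat.cast_nonneg j
  constructor
  · have h1 : (j : ℝ) / (k + a) ≤ j / k :=
      div_le_div_of_nonneg_left hj0 (by linarith) (by linarith)
    linarith [lower j]
  · have h1 := dist_pow_smul_le g x j
    have h2 : (j : ℝ) * a ≤ (k + a) * j := by nlinarith
    have : 0 ≤ 2 + 2 * dist x y + k * a := by positivity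
    linarith

end Action

/-! ### Acylindricity and the product. -/

/-- Under an acylindrical action, an element that is uniformly almost fixing far apart pairs of
points with arbitrarily many of its powers has finite order. -/
theorem IsAcylindricalAction.isOfFinOrder {G X : Type*} [Group G] [MetricSpace X]
    [MulAction G X] (hacyl : IsAcylindricalAction G X) (g : G) {C : ℝ}
    (hC : 0 ≤ C) (hg : ∀ (N : ℕ) (R : ℝ), ∃ x y : X, R ≤ dist x y ∧
      ∀ k ≤ N, dist (g ^ k • x) x ≤ C ∧ dist (g ^ k • y) y ≤ C) : IsOfFinOrder g := by
  by_contra hfin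
  obtain ⟨N, R, hNR⟩ := hacyl C hC
  obtain ⟨x, y, hxy, hk⟩ := hg N R
  have hinj : Function.Injective fun n : ℕ => g ^ n := injective_pow_iff_not_isOfFinOrder.2 hfin
  have hsub : (fun n : ℕ => g ^ n) '' (Finset.range (N + 1) : Set ℕ) ⊆
      {g : G | dist (g • x) x ≤ C ∧ dist (g • y) y ≤ C} := by
    rintro _ ⟨k, hk', rfl⟩
    exact hk k (by simpa [Nat.lt_succ_iff] using hk')
  have h1 := (Set.encard_le_encard hsub).trans (hNR x y hxy)
  rw [hinj.encard_image, Set.encard_coe_eq_coe_finsetCard, Finset.card_range] at h1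
  have : N + 1 ≤ N := by exact_mod_cast h1
  omega

theorem IsOfFinOrder.isEllipticElement {G X : Type*} [Group G] [MetricSpace X]
    [MulAction G X] {g : G} (hg : IsOfFinOrder g) : IsEllipticElement X g := by
  intro x
  have : Finite (Subgroup.zpowers g) := finite_zpowers.2 hg
  exact (Set.finite_range fun a : Subgroup.zpowers g => a • x).isBounded

theorem PiLp.dist_one_eq_sum {ι : Type*} [Fintype ι] {X : ι → Type*} [∀ i, MetricSpace (X i)]
    (p q : PiLp 1 X) : dist p q = ∑ i, dist (p i) (q i) := by
  rw [PiLp.dist_eq_sum (by norm_num)]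
  simp

theorem mainTheorem7 {G : Type*} [Group G] {r : ℕ} (X : Fin r → Type*)
    [∀ i, MetricSpace (X i)] (hX : ∀ i, IsHyperbolicSpace (X i))
    [MulAction G (PiLp 1 X)] [IsIsometricSMul G (PiLp 1 X)]
    (hfac : PreservesFactors G X) (hacyl : IsAcylindricalAction G (PiLp 1 X)) (g : G) :
    ¬ IsParabolicElement (PiLp 1 X) g := by
  rintro ⟨hell, hlox⟩
  have hunb : ∃ x : PiLp 1 X, ∀ B : ℝ, ∃ k : ℕ, B < dist (g ^ k • x) x := by
    by_contra! hcon
    exact hell (isEllipticElement_of_forall_pow hcon)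
  obtain ⟨x₀, hx₀⟩ := hunb
  obtain ⟨h, hh⟩ := hfac g
  have hpow : ∀ (k : ℕ) (p : PiLp 1 X) (i : Fin r), (g ^ k • p) i = (h i ^ k) (p i) := by
    intro k
    induction k with
    | zero => intro p i; simp
    | succ k ih =>
      intro p i
      rw [pow_succ, mul_smul, ih, hh, pow_succ, IsometryEquiv.mul_apply]
  have hdist : ∀ p q : PiLp 1 X, dist p q = ∑ i, dist (p i) (q i) := PiLp.dist_one_eq_sum
  have hcoord : ∀ (p q : PiLp 1 X) (i : Fin r), dist (p i) (q i) ≤ dist p q := by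
    intro p q i
    rw [hdist]
    exact Finset.single_le_sum (f := fun i => dist (p i) (q i)) (fun _ _ => dist_nonneg)
      (Finset.mem_univ i)
  choose δ hδ hfour using fun i => (hX i).exists_fourPoint
  have hslow : ∀ (i : Fin r) (k : ℕ) (p : X i), dist p ((h i ^ k) ((h i ^ k) p)) ≤
      dist p ((h i ^ k) p) + 2 * δ i + 1 := by
    intro i k p
    by_contra! hcon
    refine hlox (isLoxodromicElement_of_linear_growth (k := k)
      (WithLp.toLp 1 (Function.update x₀.ofLp i p)) fun n => ?_)
    refine ((hfour i).linear_growth (hδ i) (h i ^ k) p hcon n).trans ?_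
    refine le_trans (le_of_eq ?_) (hcoord _ _ i)
    rw [hpow, pow_mul]
    simp
  -- `C` must precede `N` and `R`, since acylindricity fixes them only after `C`. One factor with
  -- far apart points suffices, so separation is required only where the orbit is unbounded.
  have hpts : ∀ i, ∃ C : ℝ, 0 ≤ C ∧ ∀ (N : ℕ) (R : ℝ), ∃ p q : X i,
      ((∀ B : ℝ, ∃ k : ℕ, B < dist ((h i ^ k) (x₀ i)) (x₀ i)) → R ≤ dist p q) ∧
      ∀ k ≤ N, dist ((h i ^ k) p) p ≤ C ∧ dist ((h i ^ k) q) q ≤ C := by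
    intro i
    by_cases hi : ∀ B : ℝ, ∃ k : ℕ, B < dist ((h i ^ k) (x₀ i)) (x₀ i)
    · refine ⟨16 * δ i + 1, by linarith [hδ i], fun N R => ?_⟩
      obtain ⟨p, q, hpq, hk⟩ := (hfour i).exists_far_almost_fixed (hδ i) (hX i).1 (h i)
        (hslow i) (x₀ i) hi N R
      exact ⟨p, q, fun _ => hpq, hk⟩
    · have hi' := hi
      push Not at hi'
      obtain ⟨B, hB⟩ := hi'
      exact ⟨B, dist_nonneg.trans (hB 0), fun N R => ⟨x₀ i, x₀ i, fun h' => absurd h' hi,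
        fun k _ => ⟨hB k, hB k⟩⟩⟩
  obtain ⟨i₀, hi₀⟩ : ∃ i, ∀ B : ℝ, ∃ k : ℕ, B < dist ((h i ^ k) (x₀ i)) (x₀ i) := by
    by_contra! hcon
    choose B hB using hcon
    obtain ⟨k, hk⟩ := hx₀ (∑ i, B i)
    rw [hdist] at hk
    refine absurd hk (not_lt.2 (Finset.sum_le_sum fun i _ => ?_))
    rw [hpow]
    exact hB i k
  choose C hC hCpts using hpts
  refine hell (hacyl.isOfFinOrder g (C := ∑ i, C i) (Finset.sum_nonneg fun i _ => hC i)
    fun N R => ?_).isEllipticElement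
  choose p q hpq hk using fun i => hCpts i N R
  refine ⟨WithLp.toLp 1 p, WithLp.toLp 1 q, (hpq i₀ hi₀).trans (hcoord _ _ i₀), fun k hkN => ?_⟩
  rw [hdist, hdist]
  exact ⟨Finset.sum_le_sum fun i _ => by rw [hpow]; exact (hk i k hkN).1,
    Finset.sum_le_sum fun i _ => by rw [hpow]; exact (hk i k hkN).2⟩
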